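/- Let $\mathcal E=\{p_j,\rho_j\}_{j\in\mathcal A}$ be a finite ensemble of density matrices on a finite-dimensional Hilbert space $\mathcal H$, with average state $\rho=\sum_j p_j\rho_j$, von Neumann entropy $S(\sigma)=-\operatorname{Tr}[\sigma\log_2\sigma]$ and Holevo information $\chi=S(\rho)-\sum_j p_jS(\rho_j)$. For $\vec j\in\mathcal A^n$ put $p_{\vec j}=\prod_i p_{j_i}$ and $\rho_{\vec j}=\rho_{j_1}\otimes\dots\otimes\rho_{j_n}$. Let $\delta>0$. Let $P$ be the projector onto the $\delta$-typical subspace of $\rho^{\otimes n}$, spanned by the product eigenvectors $e_{\vec x}=e_{x_1}\otimes\dots\otimes e_{x_n}$ of $\rho^{\otimes n}$ whose eigenvalue $q_{\vec x}>0$ satisfies $|-\frac1n\log_2 q_{\vec x}-S(\rho)|\le\delta$. Let $P_{\vec j}$ be the projector onto the $\delta$-conditionally typical subspace of $\rho_{\vec j}$, spanned by the product eigenvectors of $\rho_{\vec j}$ whose eigenvalue $\lambda>0$ satisfies $|-\frac1n\log_2\lambda-\sum_jp_jS(\rho_j)|\le\delta$, and let $Q_{\vec j}=\mathbf 1-P_{\vec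 j}$. Let $R<\chi-2\delta$ (such a $\delta>0$ exists for every rate $R<\chi$). For each $n$ let $N=2^{m_n}$, where $m_n\ge 0$ is an integer with $m_n\le nR$ (for instance $m_n=nR$ when this is an integer, or $m_n=\lfloor nR\rfloor$), and identify the messages $\ell\in\{1,\dots,N\}$ with the bit strings $\vec k^{(\ell)}$ of length $m_n$ by an arbitrary fixed bijection. For a code $c=(\vec j^{(1)},\dots,\vec j^{(N)})$ of $N$ codewords of length $n$ put $$E_\ell=Q_{\vec j^{(1)}}\cdots Q_{\vec j^{(\ell-1)}}P_{\vec j^{(\ell)}}Q_{\vec j^{(\ell-1)}}\cdots Q_{\vec j^{(1)}},\qquad N^{(u)}_{k_1,\dots,k_u}=\sum_{\ell:\ (k^{(\ell)}_1,\dots,k^{(\ell)}_u)=(k_1,\dots,k_u)}E_\ell ,$$ let $$p_{succ}(\ell)=\operatorname{Tr}\Big[\Big|\sqrt{N^{(m_n)}_{k^{(\ell)}_1,\dots,k^{(\ell)}_{m_n}}}\cdots\sqrt{N^{(1)}_{k^{(\ell)}_1}}\Big|^2\rho_{\vec j^{(\ell)}}\Big]$$ be the probability that the bisection protocol with these set measurements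 decodes the $\ell$-th codeword correctly, and let $P_{err}=1-\frac1N\sum_\ell p_{succ}(\ell)$. Let $\langle\cdot\rangle_{\mathcal S}$ denote the average over random codes, in which the $N$ codewords are drawn independently, each with distribution $p_{\vec j}$. Then: 1. For every $n$, every code and all bits $k_1,\dots,k_{u-1}$, the operators $N^{(u)}_{k_1,\dots,k_{u-1},0}$, $N^{(u)}_{k_1,\dots,k_{u-1},1}$ and $\mathbf 1-N^{(u)}_{k_1,\dots,k_{u-1},0}-N^{(u)}_{k_1,\dots,k_{u-1},1}$ form a POVM. 2. Sufficient condition (ii) holds: there is a function $\epsilon(n)>0$ with $n^2\epsilon(n)\to0$ as $n\to\infty$ such that, for all $n$, all $\ell\in\{1,\dots,N\}$ and all $u\in\{1,\dots,m_n\}$, $$\Big\langle\operatorname{Tr}\Big[N^{(u)}_{k^{(\ell)}_1,\dots,k^{(\ell)}_u}\,P\rho_{\vec j^{(\ell)}}P\Big]\Big\rangle_{\mathcal S}\ \ge\ 1-\epsilon(n).$$ 3. Hence the Holevo bound is achieved: $\langle p_{succ}(\ell_n)\rangle_{\mathcal S}\to1$ for every choice of messages $\ell_n\in\{1,\dots,2^{m_n}\}$,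 and $\langle P_{err}\rangle_{\mathcal S}\to0$ as $n\to\infty$. -/

import Mathlib

open Filter Topology
open scoped Matrix ComplexOrder MatrixOrder

noncomputable section

namespace Bisection

/-- A finite output ensemble `{p_j, ρ_j}`: probabilities `p_j` and density matrices `ρ_j` on the
finite-dimensional Hilbert space `ℂ^ι`. -/
structure Ensemble (A ι : Type*) [Fintype A] [Fintype ι] where
  p : A → ℝ
  p_nonneg : ∀ j, 0 ≤ p j
  p_sum : ∑ j, p j = 1
  ρ : A → Matrix ι ι ℂ
  ρ_pos : ∀ j, (ρ j).PosSemidef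
  ρ_trace : ∀ j, (ρ j).trace = 1

section Tensor

variable {ι : Type*} [Fintype ι]

/-- The tensor product `B_1 ⊗ ⋯ ⊗ B_n` as a matrix on `(ℂ^ι)^{⊗ n} = ℂ^(ι^n)`. -/
def tensorMat {n : ℕ} (B : Fin n → Matrix ι ι ℂ) : Matrix (Fin n → ι) (Fin n → ι) ℂ :=
  fun x y => ∏ i, B i (x i) (y i)

/-- The product vector `v_1 ⊗ ⋯ ⊗ v_n`. -/
def tensorVec {n : ℕ} (v : Fin n → ι → ℂ) : (Fin n → ι) → ℂ :=
  fun x => ∏ i, v i (x i)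

variable [DecidableEq ι]

/-- The von Neumann entropy `-Tr[B log₂ B] = -∑ λ log₂ λ` (with `0 log₂ 0 = 0`). -/
def vnEntropy {B : Matrix ι ι ℂ} (hB : B.IsHermitian) : ℝ :=
  -∑ x, hB.eigenvalues x * Real.logb 2 (hB.eigenvalues x)

/-- The index strings `x = (x_1, …, x_n)` such that the eigenvalue
`q_x = q^{(1)}_{x_1} ⋯ q^{(n)}_{x_n}` of `B_1 ⊗ ⋯ ⊗ B_n` satisfies
`|-(1/n) log₂ q_x - h| ≤ δ`.  A string with `q_x = 0` has infinite sample entropy,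
so it is not typical. -/
def typicalSet {n : ℕ} {B : Fin n → Matrix ι ι ℂ} (hB : ∀ i, (B i).IsHermitian) (h δ : ℝ) :
    Set (Fin n → ι) :=
  {x | 0 < ∏ i, (hB i).eigenvalues (x i) ∧
    |-(1 / (n : ℝ)) * Real.logb 2 (∏ i, (hB i).eigenvalues (x i)) - h| ≤ δ}

open Classical in
/-- The projector `∑_{x typical} |e_x⟩⟨e_x|`, where `e_x = e^{(1)}_{x_1} ⊗ ⋯ ⊗ e^{(n)}_{x_n}` and
`e^{(i)}` is an orthonormal eigenbasis of `B_i`. -/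
def typicalProj {n : ℕ} {B : Fin n → Matrix ι ι ℂ} (hB : ∀ i, (B i).IsHermitian) (h δ : ℝ) :
    Matrix (Fin n → ι) (Fin n → ι) ℂ :=
  ∑ x : Fin n → ι, if x ∈ typicalSet hB h δ then
    Matrix.vecMulVec
      (tensorVec fun i => ((hB i).eigenvectorBasis (x i)).ofLp)
      (star (tensorVec fun i => ((hB i).eigenvectorBasis (x i)).ofLp))
  else 0

end Tensor

namespace Ensemble

variable {A ι : Type*} [Fintype A] [Fintype ι] (E : Ensemble A ι)

/-- The average state `ρ = ∑_j p_j ρ_j`. -/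
def avg : Matrix ι ι ℂ := ∑ j, (E.p j : ℂ) • E.ρ j

theorem isHermitian (j : A) : (E.ρ j).IsHermitian := (E.ρ_pos j).isHermitian

theorem avg_isHermitian : E.avg.IsHermitian := by
  unfold avg Matrix.IsHermitian
  rw [Matrix.conjTranspose_sum]
  refine Finset.sum_congr rfl fun j _ => ?_
  rw [Matrix.conjTranspose_smul, (E.isHermitian j).eq]
  simp

/-- The codeword state `ρ_{j_1} ⊗ ⋯ ⊗ ρ_{j_n}`. -/
def codeState {n : ℕ} (j : Fin n → A) : Matrix (Fin n → ι) (Fin n → ι) ℂ :=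
  tensorMat fun i => E.ρ (j i)

/-- The average `⟨f⟩_S` over random codes: the `N` codewords are drawn independently, each letter of
each codeword with distribution `p`. -/
def codeAvg (n N : ℕ) (f : (Fin N → Fin n → A) → ℝ) : ℝ :=
  ∑ c : Fin N → Fin n → A, (∏ l, ∏ q, E.p (c l q)) * f c

variable [DecidableEq ι]

/-- The average conditional entropy `∑_j p_j S(ρ_j)`. -/
def condEntropy : ℝ := ∑ j, E.p j * vnEntropy (E.isHermitian j)

/-- The Holevo information `χ = S(∑_j p_j ρ_j) - ∑_j p_j S(ρ_j)`. -/
def holevo : ℝ := vnEntropy E.avg_isHermitian - E.condEntropy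

/-- The projector `P` on the `δ`-typical subspace of `ρ^{⊗ n}`. -/
def typP (n : ℕ) (δ : ℝ) : Matrix (Fin n → ι) (Fin n → ι) ℂ :=
  typicalProj (fun _ : Fin n => E.avg_isHermitian) (vnEntropy E.avg_isHermitian) δ

/-- The projector `P_j` on the `δ`-conditionally typical subspace of the codeword state `ρ_j`. -/
def condP {n : ℕ} (δ : ℝ) (j : Fin n → A) : Matrix (Fin n → ι) (Fin n → ι) ℂ :=
  typicalProj (fun i => E.isHermitian (j i)) E.condEntropy δ

/-- The complementary projectors `Q_{j^{(1)}}, …, Q_{j^{(l-1)}}` of the codewords that precede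
the `l`-th one, in this order. -/
def precedingQ {n N : ℕ} (δ : ℝ) (c : Fin N → Fin n → A) (l : Fin N) :
    List (Matrix (Fin n → ι) (Fin n → ι) ℂ) :=
  ((List.finRange N).filter (· < l)).map fun l' => 1 - E.condP δ (c l')

/-- The element `E_l = Q_1 ⋯ Q_{l-1} P_l Q_{l-1} ⋯ Q_1` of the sequential POVM. -/
def seqElem {n N : ℕ} (δ : ℝ) (c : Fin N → Fin n → A) (l : Fin N) :
    Matrix (Fin n → ι) (Fin n → ι) ℂ :=
  (E.precedingQ δ c l).prod * E.condP δ (c l) * (E.precedingQ δ c l).reverse.prod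

end Ensemble

/-- The bit string that a labelling of `N = 2^m` messages by `m` bits assigns to a message. -/
def bitString {m : ℕ} (enc : Fin (2 ^ m) ≃ (Fin m → Bool)) (l : Fin (2 ^ m)) : List Bool :=
  List.ofFn (enc l)

namespace Ensemble

variable {A ι : Type*} [Fintype A] [Fintype ι] [DecidableEq ι] (E : Ensemble A ι)
variable {n m : ℕ} (δ : ℝ) (enc : Fin (2 ^ m) ≃ (Fin m → Bool)) (c : Fin (2 ^ m) → Fin n → A)

/-- The set measurement `N^{(u)}_{k_1, …, k_u}`, `k = (k_1, …, k_u)`: the sum of the `E_l` over the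
messages `l` whose bit string starts with `k`. -/
def setMeas (k : List Bool) : Matrix (Fin n → ι) (Fin n → ι) ℂ :=
  ∑ l ∈ Finset.univ.filter (fun l => k <+: bitString enc l), E.seqElem δ c l

/-- The product `√N^{(m)}_{k_1, …, k_m} ⋯ √N^{(2)}_{k_1, k_2} √N^{(1)}_{k_1}`
for the bit string `k` of the message `l`. -/
def bisOp (l : Fin (2 ^ m)) : Matrix (Fin n → ι) (Fin n → ι) ℂ :=
  ((List.range m).map fun u =>
    CFC.sqrt (E.setMeas δ enc c ((bitString enc l).take (u + 1)))).reverse.prod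

/-- The probability `Tr[F ρ]`, `F = |√N^{(m)} ⋯ √N^{(1)}|²`, that the bisection protocol correctly
decodes the `l`-th codeword. -/
def pSucc (l : Fin (2 ^ m)) : ℝ :=
  (((E.bisOp δ enc c l)ᴴ * E.bisOp δ enc c l) * E.codeState (c l)).trace.re

/-- The average error probability of the code `c` under the bisection protocol. -/
def pErr : ℝ := 1 - (1 / (2 ^ m : ℝ)) * ∑ l, E.pSucc δ enc c l

end Ensemble

/-- `N₀`, `N₁` and the null element `1 - N₀ - N₁` form a POVM. -/
def IsThreeOutcomePOVM {κ : Type*} [Fintype κ] [DecidableEq κ] (N₀ N₁ : Matrix κ κ ℂ) : Prop :=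
  N₀.PosSemidef ∧ N₁.PosSemidef ∧ (1 - N₀ - N₁).PosSemidef

end Bisection

end

/-!
The proof rests on one operator inequality. For operators `0 ≤ a_i ≤ 1` and `X = a_k ⋯ a_1`,
`1 - X†X ≤ 4 ∑ (1 - a_i²)` (`union_bound`): a sequence of measurements, each of which almost
certainly succeeds, succeeds as a whole, with an error that is linear in the individual errors. It
follows from `4 - 2X - 2X† ≤ 4 ∑ (1 - a_i²) + (1 - X†X)`, which is proved one factor at a time by
completing a square, because `4 - 2X - 2X† = 2 (1 - X†X) + 2 (1 - X)†(1 - X)`.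

Applied to `Q_1, …, Q_{l-1}, P_l`, it bounds the error of the sequential element `E_l` on the
compressed state `P ρ_l P` by the probabilities that `P_l` rejects and that some `P_i`, `i < l`,
accepts (`one_sub_seqElem_le`). Averaged over random codes, the first is a large-deviation
probability, exponentially small by a Chernoff bound (`exists_typP_tail`, `exists_condP_tail`). The
second is at most `2^{nR} 2^{-n(χ - 2δ)}`, since `P ρ^{⊗n} P ≤ 2^{-n(S(ρ) - δ)}` and
`Tr P_i ≤ 2^{n(∑ p_j S(ρ_j) + δ)}` (`avg_cross_le`). As `E_l ≤ N^{(u)}` for every prefix of the bit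
string of `l`, the bound on `⟨Tr[N^{(u)} P ρ_l P]⟩` holds with `ε(n) = 38 rⁿ` for some `r < 1`.

Applied to the factors `√N^{(u)}`, the same inequality bounds the error of the bisection protocol by
`4 ∑_u Tr[(1 - N^{(u)}) ρ_l]` (`one_sub_pSucc_le`), and the average of this is at most a constant
times `m ε(n) ≤ nR ε(n)`, uniformly in `l`. The POVM property holds since the `E_l` sum to at most
the identity (`sum_seqElem_le_one`), by a telescoping sum.
-/

open Filter Topology
open scoped Matrix ComplexOrder MatrixOrder

noncomputable section

namespace Bisection

/-! ### Operator inequalities in a star-ordered ring -/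

section StarOrdered

variable {R : Type*} [Ring R] [StarRing R] [PartialOrder R] [StarOrderedRing R]

/-- Since `a - a² = a (1 - a) a + (1 - a) a (1 - a)`. -/
theorem nonneg_sub_mul_self {a : R} (h0 : 0 ≤ a) (h1 : a ≤ 1) : 0 ≤ a - a * a := by
  have ha : star a = a := (IsSelfAdjoint.of_nonneg h0).star_eq
  have h1' : 0 ≤ 1 - a := sub_nonneg.2 h1
  have e1 := star_left_conjugate_nonneg h1' a
  have e2 := star_left_conjugate_nonneg h0 (1 - a)
  have := add_nonneg e1 e2
  rw [star_sub, star_one, ha] at this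
  convert this using 1
  noncomm_ring

/-- Since `2 (1 - a) = (1 - a²) + (1 - a)²`; the factor `2` avoids dividing in `R`. -/
theorem two_mul_one_sub_nonneg {a : R} (h0 : 0 ≤ a) (h1 : a * a ≤ 1) :
    0 ≤ 2 * (1 - a) := by
  have ha : star a = a := (IsSelfAdjoint.of_nonneg h0).star_eq
  have := add_nonneg (sub_nonneg.2 h1) (star_mul_self_nonneg (1 - a))
  rw [star_sub, star_one, ha] at this
  convert this using 1
  noncomm_ring

theorem star_reverse_prod {L : List R} (hL : ∀ a ∈ L, 0 ≤ a) : star L.reverse.prod = L.prod := by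
  induction L with
  | nil => simp
  | cons a L ih =>
    have ha : star a = a := (IsSelfAdjoint.of_nonneg (hL a (by simp))).star_eq
    simp [ih fun b hb => hL b (by simp [hb]), ha]

theorem prod_mul_reverse_prod_nonneg {L : List R} (hL : ∀ a ∈ L, 0 ≤ a) :
    0 ≤ L.prod * L.reverse.prod := by
  rw [← star_reverse_prod hL]
  exact star_mul_self_nonneg _

theorem prod_mul_reverse_prod_le_one {L : List R} (hL : ∀ a ∈ L, 0 ≤ a ∧ a ≤ 1) :
    L.prod * L.reverse.prod ≤ 1 := by
  induction L with
  | nil => simp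
  | cons a L ih =>
    have h := hL a (by simp)
    have ha : star a = a := (IsSelfAdjoint.of_nonneg h.1).star_eq
    have e := star_left_conjugate_le_conjugate (ih fun b hb => hL b (by simp [hb])) a
    have e2 : a * a ≤ 1 := (sub_nonneg.1 (nonneg_sub_mul_self h.1 h.2)).trans h.2
    rw [ha, mul_one] at e
    calc _ = a * (L.prod * L.reverse.prod) * a := by simp [mul_assoc]
      _ ≤ _ := e.trans e2

/-- With `X = a_k ⋯ a_1`, the inequality `4 - 2X - 2X† ≤ 4 ∑ (1 - a_i²) + (1 - X†X)`.  It is additive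
in the factors, so it follows by induction on their number. -/
theorem union_bound_aux (L : List R) (hL : ∀ a ∈ L, 0 ≤ a ∧ a ≤ 1) :
    0 ≤ 4 * (L.map fun a => 1 - a * a).sum + (1 - star L.reverse.prod * L.reverse.prod)
      - (2 * (1 - L.reverse.prod) + 2 * (1 - star L.reverse.prod)) := by
  induction L using List.reverseRecOn with
  | nil =>
    simp
  | append_singleton L a ih =>
    have h := hL a (by simp)
    have ha : star a = a := (IsSelfAdjoint.of_nonneg h.1).star_eq
    have ih := ih fun b hb => hL b (by simp [hb])
    have hq := nonneg_sub_mul_self h.1 h.2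
    simp only [List.reverse_append, List.reverse_cons, List.reverse_nil, List.nil_append,
      List.prod_append, List.prod_singleton, List.map_append, List.map_cons, List.map_nil,
      List.sum_append, List.sum_singleton]
    generalize L.reverse.prod = X at *
    generalize (L.map fun a => 1 - a * a).sum = S at *
    -- completing the square: the increment of the claim is, up to nonnegative terms,
    -- `(2 - X)† (1 - a) (2 - X)`
    have e1 := star_left_conjugate_nonneg (sub_nonneg.2 h.2) (1 + (1 - X))
    have e2 := star_left_conjugate_nonneg hq X
    have e3 : 0 ≤ (a - a * a) + (a - a * a) + ((a - a * a) + (a - a * a)) :=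
      add_nonneg (add_nonneg hq hq) (add_nonneg hq hq)
    have := add_nonneg (add_nonneg (add_nonneg ih e1) e2) e3
    convert this using 1
    simp only [star_mul, star_sub, star_add, star_one, ha]
    noncomm_ring

/-- Noncommutative union bound: the probability that a sequence of measurements with operators
`0 ≤ a_i ≤ 1` fails at some step is at most four times the sum of the individual failure
probabilities. -/
theorem union_bound (L : List R) (hL : ∀ a ∈ L, 0 ≤ a ∧ a ≤ 1) :
    1 - L.prod * L.reverse.prod ≤ 4 * (L.map fun a => 1 - a * a).sum := by
  have h := union_bound_aux L hL
  have hs := star_reverse_prod fun a ha => (hL a ha).1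
  have h2 := star_mul_self_nonneg (1 - L.reverse.prod)
  have := add_nonneg h (add_nonneg h2 h2)
  rw [star_sub, star_one, hs] at this
  rw [← sub_nonneg]
  convert this using 1
  noncomm_ring

/-- The difference of the two sides is `(2p - 1) a (2p - 1)`. -/
theorem pinching {a : R} (ha : 0 ≤ a) {p : R} (hp : star p = p) :
    a ≤ 2 * (p * a * p) + 2 * ((1 - p) * a * (1 - p)) := by
  have := star_left_conjugate_nonneg ha (p - (1 - p))
  rw [star_sub, star_sub, star_one, hp] at this
  rw [← sub_nonneg]
  convert this using 1
  noncomm_ring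

/-- The difference of the two sides is `(2 - p) a (2 - p)`. -/
theorem compression_le {a : R} (ha : 0 ≤ a) {p : R} (hp : star p = p) :
    p * a * p ≤ 2 * a + 2 * ((1 - p) * a * (1 - p)) := by
  have := star_left_conjugate_nonneg ha (1 + (1 - p))
  rw [star_add, star_sub, star_one, hp] at this
  rw [← sub_nonneg]
  convert this using 1
  noncomm_ring

end StarOrdered

/-- The sequential elements `q₀ ⋯ q_{l-1} p_l q_{l-1} ⋯ q₀`, `q = 1 - p`, telescope: with the
all-failed outcome they resolve the identity. -/
theorem sum_sequential {R : Type*} [Ring R] {N : ℕ} (p : Fin N → R) (hp : ∀ l, p l * p l = p l) :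
    ∑ l, ((((List.finRange N).filter (· < l)).map fun i => 1 - p i).prod * p l *
      (((List.finRange N).filter (· < l)).map fun i => 1 - p i).reverse.prod) =
    1 - ((List.finRange N).map fun i => 1 - p i).prod *
      ((List.finRange N).map fun i => 1 - p i).reverse.prod := by
  induction N with
  | zero => simp
  | succ N ih =>
    have h1 : ∀ l : Fin N, (List.finRange (N + 1)).filter (· < l.castSucc) =
        ((List.finRange N).filter (· < l)).map Fin.castSucc := by
      intro l
      rw [List.finRange_succ_last, List.filter_append, List.filter_map]
      have : List.filter (fun x => decide (x < l.castSucc)) [Fin.last N] = [] := by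
        simp [Fin.le_last]
      rw [this, List.append_nil]
      congr 1
    have h2 : (List.finRange (N + 1)).filter (· < Fin.last N) =
        (List.finRange N).map Fin.castSucc := by
      rw [List.finRange_succ_last, List.filter_append, List.filter_map]
      simp [Function.comp_def, Fin.castSucc_lt_last]
    rw [Fin.sum_univ_castSucc, h2]
    simp only [h1, List.map_map, Function.comp_def]
    rw [ih (fun l => p l.castSucc) fun l => hp _, List.finRange_succ_last]
    simp only [List.map_append, List.map_map, Function.comp_def, List.map_cons, List.map_nil,
      List.reverse_append, List.prod_append, List.prod_singleton, List.reverse_cons,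
      List.reverse_nil, List.nil_append]
    generalize (List.map (fun i : Fin N => 1 - p i.castSucc) (List.finRange N)).prod = X
    generalize (List.map (fun i : Fin N => 1 - p i.castSucc) (List.finRange N)).reverse.prod = Y
    have : (1 - p (Fin.last N)) * (1 - p (Fin.last N)) = 1 - p (Fin.last N) := by
      simp [sub_mul, mul_sub, hp]
    calc 1 - X * Y + X * p (Fin.last N) * Y = 1 - X * (1 - p (Fin.last N)) * Y := by noncomm_ring
      _ = 1 - X * ((1 - p (Fin.last N)) * (1 - p (Fin.last N))) * Y := by rw [this]
      _ = _ := by noncomm_ring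

/-! ### Traces of products of positive matrices -/

section Trace

variable {κ : Type*} [Fintype κ]

theorem re_trace_mul_nonneg {M σ : Matrix κ κ ℂ} (hM : 0 ≤ M) (hσ : 0 ≤ σ) :
    0 ≤ (M * σ).trace.re := by
  classical
  obtain ⟨B, rfl⟩ := CStarAlgebra.nonneg_iff_eq_star_mul_self.mp hσ
  have := (Matrix.nonneg_iff_posSemidef.1 (star_right_conjugate_nonneg hM B)).trace_nonneg
  rw [← mul_assoc, Matrix.trace_mul_comm, ← mul_assoc]
  exact (Complex.le_def.1 this).1

theorem re_trace_mul_le {M M' σ : Matrix κ κ ℂ} (hM : M ≤ M') (hσ : 0 ≤ σ) :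
    (M * σ).trace.re ≤ (M' * σ).trace.re := by
  have := re_trace_mul_nonneg (sub_nonneg.2 hM) hσ
  rw [sub_mul, Matrix.trace_sub, Complex.sub_re] at this
  linarith

variable [DecidableEq κ]

theorem re_trace_two_mul (M σ : Matrix κ κ ℂ) :
    (2 * M * σ).trace.re = 2 * (M * σ).trace.re := by
  rw [two_mul, add_mul, Matrix.trace_add, Complex.add_re, two_mul]

theorem re_trace_four_mul (M σ : Matrix κ κ ℂ) :
    (4 * M * σ).trace.re = 4 * (M * σ).trace.re := by
  have : 4 * M = 2 * (2 * M) := by noncomm_ring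
  rw [this, re_trace_two_mul, re_trace_two_mul]
  ring

theorem sqrt_le_one {M : Matrix κ κ ℂ} (h0 : 0 ≤ M) (h1 : M ≤ 1) : CFC.sqrt M ≤ 1 := by
  have := two_mul_one_sub_nonneg (CFC.sqrt_nonneg M)
    (by rwa [CFC.sqrt_mul_sqrt_self M h0])
  rw [← sub_nonneg]
  have h := (Matrix.nonneg_iff_posSemidef.1 this).smul (α := ℝ) (a := 1/2) (by norm_num)
  convert h.nonneg using 1
  rw [two_mul, ← two_smul ℝ, smul_smul]
  norm_num

end Trace

/-! ### Product eigenbases and typical projectors -/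

section Tensor

variable {ι : Type*} {n : ℕ}

theorem conjTranspose_tensorMat (B : Fin n → Matrix ι ι ℂ) :
    (tensorMat B)ᴴ = tensorMat fun i => (B i)ᴴ := by
  ext x y
  simp [tensorMat, Matrix.conjTranspose_apply]

variable [DecidableEq ι]

theorem tensorMat_diagonal (d : Fin n → ι → ℂ) :
    tensorMat (fun i => Matrix.diagonal (d i)) = Matrix.diagonal fun x => ∏ i, d i (x i) := by
  ext x y
  by_cases h : x = y
  · subst h; simp [tensorMat]
  · obtain ⟨i, hi⟩ := Function.ne_iff.1 h
    rw [Matrix.diagonal_apply_ne _ h]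
    exact Finset.prod_eq_zero (Finset.mem_univ i) (Matrix.diagonal_apply_ne _ hi)

theorem tensorMat_one : tensorMat (fun _ : Fin n => (1 : Matrix ι ι ℂ)) = 1 := by
  have := tensorMat_diagonal (n := n) fun _ (_ : ι) => (1 : ℂ)
  simpa using this

end Tensor

section Typical

variable {ι : Type*} [Fintype ι] {n : ℕ}

theorem tensorMat_mul (B C : Fin n → Matrix ι ι ℂ) :
    tensorMat B * tensorMat C = tensorMat fun i => B i * C i := by
  classical
  ext x y
  simp only [tensorMat, Matrix.mul_apply]
  rw [Finset.prod_univ_sum]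
  simp [Finset.prod_mul_distrib]

variable [DecidableEq ι] {B : Fin n → Matrix ι ι ℂ} (hB : ∀ i, (B i).IsHermitian)

/-- The unitary matrix whose columns are the product eigenvectors `e_x`. -/
def prodBasis : Matrix (Fin n → ι) (Fin n → ι) ℂ :=
  tensorMat fun i => ((hB i).eigenvectorUnitary : Matrix ι ι ℂ)

theorem prodBasis_conjTranspose_mul_self : (prodBasis hB)ᴴ * prodBasis hB = 1 := by
  unfold prodBasis
  rw [conjTranspose_tensorMat, tensorMat_mul, ← tensorMat_one]
  congr 1
  funext i
  exact Unitary.coe_star_mul_self _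

theorem prodBasis_mul_conjTranspose_self : prodBasis hB * (prodBasis hB)ᴴ = 1 :=
  mul_eq_one_comm.1 (prodBasis_conjTranspose_mul_self hB)

/-- The operator `V diag(d) V†` that is diagonal with entries `d` in the product eigenbasis. -/
def conjDiag (d : (Fin n → ι) → ℝ) : Matrix (Fin n → ι) (Fin n → ι) ℂ :=
  prodBasis hB * Matrix.diagonal (fun x => (d x : ℂ)) * (prodBasis hB)ᴴ

/-- The spectral theorem for a product operator. -/
theorem tensorMat_eq_conjDiag :
    tensorMat B = conjDiag hB fun x => ∏ i, (hB i).eigenvalues (x i) := by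
  unfold conjDiag
  have : (fun x : Fin n → ι => ((∏ i, (hB i).eigenvalues (x i) : ℝ) : ℂ)) =
      fun x => ∏ i, ((RCLike.ofReal ∘ (hB i).eigenvalues : ι → ℂ)) (x i) := by
    funext x; simp
  rw [this, ← tensorMat_diagonal]
  unfold prodBasis
  rw [conjTranspose_tensorMat, tensorMat_mul, tensorMat_mul]
  congr 1
  funext i
  exact (hB i).spectral_theorem

open Classical in
theorem typicalProj_eq_conjDiag (h δ : ℝ) :
    typicalProj hB h δ = conjDiag hB fun x => if x ∈ typicalSet hB h δ then 1 else 0 := by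
  ext y z
  rw [conjDiag, Matrix.mul_apply]
  simp only [typicalProj, Matrix.sum_apply, Matrix.mul_diagonal]
  refine Finset.sum_congr rfl fun x _ => ?_
  split_ifs
  · simp [Matrix.vecMulVec_apply, tensorVec, prodBasis, tensorMat, Matrix.conjTranspose_apply,
      Matrix.IsHermitian.eigenvectorUnitary_apply]
  · simp

theorem conjDiag_mul (d e : (Fin n → ι) → ℝ) :
    conjDiag hB d * conjDiag hB e = conjDiag hB fun x => d x * e x := by
  unfold conjDiag
  calc _ = prodBasis hB * Matrix.diagonal (fun x => (d x : ℂ)) *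
        ((prodBasis hB)ᴴ * prodBasis hB) * Matrix.diagonal (fun x => (e x : ℂ)) *
          (prodBasis hB)ᴴ := by simp only [mul_assoc]
    _ = prodBasis hB * (Matrix.diagonal (fun x => (d x : ℂ)) *
          Matrix.diagonal (fun x => (e x : ℂ))) * (prodBasis hB)ᴴ := by
      rw [prodBasis_conjTranspose_mul_self]; simp only [mul_assoc, mul_one]
    _ = _ := by rw [Matrix.diagonal_mul_diagonal]; simp

theorem conjDiag_sub (d e : (Fin n → ι) → ℝ) :
    conjDiag hB d - conjDiag hB e = conjDiag hB fun x => d x - e x := by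
  unfold conjDiag
  rw [← sub_mul, ← mul_sub, Matrix.diagonal_sub]
  simp

theorem conjDiag_const (r : ℝ) : conjDiag hB (fun _ => r) = (r : ℂ) • 1 := by
  unfold conjDiag
  have : Matrix.diagonal (fun _ : Fin n → ι => (r : ℂ)) = (r : ℂ) • 1 := by
    rw [← Matrix.diagonal_one, ← Matrix.diagonal_smul]; congr 1; funext; simp
  rw [this, mul_smul_comm, smul_mul_assoc, mul_one, prodBasis_mul_conjTranspose_self]

theorem conjDiag_nonneg {d : (Fin n → ι) → ℝ} (hd : ∀ x, 0 ≤ d x) : 0 ≤ conjDiag hB d := by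
  apply star_right_conjugate_nonneg
  rw [Matrix.nonneg_iff_posSemidef]
  exact Matrix.PosSemidef.diagonal fun x => by simpa using hd x

theorem re_trace_conjDiag (d : (Fin n → ι) → ℝ) : (conjDiag hB d).trace.re = ∑ x, d x := by
  unfold conjDiag
  rw [Matrix.trace_mul_comm, ← mul_assoc, prodBasis_conjTranspose_mul_self, one_mul,
    Matrix.trace_diagonal]
  simp

theorem conjDiag_one : conjDiag hB (fun _ => 1) = 1 := by
  simpa using conjDiag_const hB 1

theorem typicalProj_mul_self (h δ : ℝ) :
    typicalProj hB h δ * typicalProj hB h δ = typicalProj hB h δ := by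
  classical
  rw [typicalProj_eq_conjDiag, conjDiag_mul]
  congr 1
  funext x
  split_ifs <;> simp

theorem typicalProj_nonneg (h δ : ℝ) : 0 ≤ typicalProj hB h δ := by
  classical
  rw [typicalProj_eq_conjDiag]
  exact conjDiag_nonneg hB fun x => by split_ifs <;> norm_num

theorem one_sub_typicalProj_nonneg (h δ : ℝ) : 0 ≤ 1 - typicalProj hB h δ := by
  classical
  rw [typicalProj_eq_conjDiag, ← conjDiag_one hB, conjDiag_sub]
  exact conjDiag_nonneg hB fun x => by split_ifs <;> norm_num

theorem rpow_le_of_mem_typicalSet (hn : 0 < n) {h δ : ℝ} {x : Fin n → ι}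
    (hx : x ∈ typicalSet hB h δ) :
    (2 : ℝ) ^ (-(n * (h + δ))) ≤ ∏ i, (hB i).eigenvalues (x i) := by
  obtain ⟨h0, h1⟩ := hx
  have hn' : (0 : ℝ) < n := by exact_mod_cast hn
  rw [← Real.le_logb_iff_rpow_le (by norm_num) h0]
  have := (abs_le.1 h1).2
  have h2 : (n : ℝ) * (-(1 / (n : ℝ)) * Real.logb 2 (∏ i, (hB i).eigenvalues (x i))) =
      -Real.logb 2 (∏ i, (hB i).eigenvalues (x i)) := by field_simp
  nlinarith

theorem le_rpow_of_mem_typicalSet (hn : 0 < n) {h δ : ℝ} {x : Fin n → ι}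
    (hx : x ∈ typicalSet hB h δ) :
    ∏ i, (hB i).eigenvalues (x i) ≤ (2 : ℝ) ^ (-(n * (h - δ))) := by
  obtain ⟨h0, h1⟩ := hx
  have hn' : (0 : ℝ) < n := by exact_mod_cast hn
  rw [← Real.logb_le_iff_le_rpow (by norm_num) h0]
  have := (abs_le.1 h1).1
  have h2 : (n : ℝ) * (-(1 / (n : ℝ)) * Real.logb 2 (∏ i, (hB i).eigenvalues (x i))) =
      -Real.logb 2 (∏ i, (hB i).eigenvalues (x i)) := by field_simp
  nlinarith

theorem lt_abs_sum_logb_of_notMem_typicalSet (hn : 0 < n) {h δ : ℝ} {x : Fin n → ι}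
    (hx : x ∉ typicalSet hB h δ) (h0 : 0 < ∏ i, (hB i).eigenvalues (x i)) :
    n * δ < |∑ i, -Real.logb 2 ((hB i).eigenvalues (x i)) - n * h| := by
  have hn' : (0 : ℝ) < n := by exact_mod_cast hn
  have h1 : δ < |-(1 / (n : ℝ)) * Real.logb 2 (∏ i, (hB i).eigenvalues (x i)) - h| := by
    by_contra hc
    exact hx ⟨h0, not_lt.1 hc⟩
  rw [Real.logb_prod _ _ fun i _ => (Finset.prod_ne_zero_iff.1 h0.ne') i (Finset.mem_univ i)] at h1
  calc n * δ < n * |-(1 / (n : ℝ)) * ∑ i, Real.logb 2 ((hB i).eigenvalues (x i)) - h| := by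
        gcongr
    _ = |n * (-(1 / (n : ℝ)) * ∑ i, Real.logb 2 ((hB i).eigenvalues (x i)) - h)| := by
        rw [abs_mul, abs_of_pos hn']
    _ = _ := by
        congr 1
        rw [Finset.sum_neg_distrib]
        field_simp

/-- Compressed to the typical subspace, a product operator is at most `2^{-n(h - δ)}`. -/
theorem typicalProj_mul_tensorMat_mul_le (hn : 0 < n) (h δ : ℝ) :
    typicalProj hB h δ * tensorMat B * typicalProj hB h δ ≤
      (((2 : ℝ) ^ (-(n * (h - δ))) : ℝ) : ℂ) • 1 := by
  classical
  rw [← conjDiag_const hB, typicalProj_eq_conjDiag, tensorMat_eq_conjDiag hB, conjDiag_mul,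
    conjDiag_mul, ← sub_nonneg, conjDiag_sub]
  refine conjDiag_nonneg hB fun x => ?_
  split_ifs with hx
  · simpa using le_rpow_of_mem_typicalSet hB hn hx
  · simp only [zero_mul, mul_zero, sub_zero]; positivity

open Classical in
theorem re_trace_one_sub_typicalProj_mul (h δ : ℝ) :
    ((1 - typicalProj hB h δ) * tensorMat B).trace.re =
      ∑ x, if x ∈ typicalSet hB h δ then 0 else ∏ i, (hB i).eigenvalues (x i) := by
  rw [typicalProj_eq_conjDiag, tensorMat_eq_conjDiag hB, ← conjDiag_one hB, conjDiag_sub,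
    conjDiag_mul, re_trace_conjDiag]
  refine Finset.sum_congr rfl fun x _ => ?_
  split_ifs <;> simp

theorem sum_eigenvalues_eq_one {B : Matrix ι ι ℂ} (hB : B.IsHermitian) (h1 : B.trace = 1) :
    ∑ x, hB.eigenvalues x = 1 := by
  have := hB.trace_eq_sum_eigenvalues
  rw [h1] at this
  simpa using (congrArg Complex.re this).symm

theorem sum_prod_eigenvalues (h1 : ∀ i, (B i).trace = 1) :
    ∑ x : Fin n → ι, ∏ i, (hB i).eigenvalues (x i) = 1 := by
  have h2 := Finset.prod_univ_sum (fun _ : Fin n => (Finset.univ : Finset ι))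
    fun i x => (hB i).eigenvalues x
  simpa [sum_eigenvalues_eq_one (hB _) (h1 _)] using h2.symm

/-- The dimension of the typical subspace of a product state is at most `2^{n(h + δ)}`. -/
theorem re_trace_typicalProj_le (hn : 0 < n) (hpos : ∀ i, (B i).PosSemidef)
    (h1 : ∀ i, (B i).trace = 1) (h δ : ℝ) :
    (typicalProj hB h δ).trace.re ≤ (2 : ℝ) ^ (n * (h + δ)) := by
  classical
  rw [typicalProj_eq_conjDiag, re_trace_conjDiag]
  have hc : (0 : ℝ) < 2 ^ (n * (h + δ)) := by positivity
  calc _ ≤ ∑ x : Fin n → ι, (2 : ℝ) ^ (n * (h + δ)) * ∏ i, (hB i).eigenvalues (x i) := by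
        refine Finset.sum_le_sum fun x _ => ?_
        split_ifs with hx
        · have := mul_le_mul_of_nonneg_left (rpow_le_of_mem_typicalSet hB hn hx) hc.le
          rwa [← Real.rpow_add (by norm_num), add_neg_cancel, Real.rpow_zero] at this
        · exact mul_nonneg hc.le (Finset.prod_nonneg fun i _ => (hpos i).eigenvalues_nonneg _)
    _ = _ := by rw [← Finset.mul_sum, sum_prod_eigenvalues hB h1, mul_one]

end Typical

/-! ### Large deviations of independent letters -/

section Chernoff

variable {Ω : Type*} [Fintype Ω] {q : Ω → ℝ}

/-- The moment generating function of a variable with negative mean drops below one: its value at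
`0` is `1` and its derivative there is the mean. -/
theorem exists_sum_mul_exp_lt_one (q1 : ∑ x, q x = 1) {g : Ω → ℝ} (hg : ∑ x, q x * g x < 0) :
    ∃ s : ℝ, 0 < s ∧ ∑ x, q x * Real.exp (s * g x) < 1 := by
  have hd : HasDerivAt (fun s : ℝ => ∑ x, q x * Real.exp (s * g x)) (∑ x, q x * g x) 0 := by
    refine HasDerivAt.fun_sum fun x _ => ?_
    have := (((hasDerivAt_id (0 : ℝ)).mul_const (g x)).exp).const_mul (q x)
    simpa using this
  have hs := (hasDerivAt_iff_tendsto_slope.1 hd).eventually (eventually_lt_nhds hg)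
  have hs' := hs.filter_mono (nhdsGT_le_nhdsNE (0 : ℝ))
  obtain ⟨s, hs, h0⟩ := (hs'.and self_mem_nhdsWithin).exists
  refine ⟨s, h0, ?_⟩
  have h0 : 0 < s := h0
  rw [slope_def_field, sub_zero, div_neg_iff] at hs
  rcases hs with hs | hs
  · linarith [hs.2]
  · have := hs.1
    simp only [zero_mul, Real.exp_zero, mul_one, q1] at this
    linarith

open Classical in
/-- One-sided Chernoff bound: the sum of `n` independent letters exceeds its mean by `nδ` with
exponentially small probability. -/
theorem exists_tail_le (q0 : ∀ x, 0 ≤ q x) (q1 : ∑ x, q x = 1) (f : Ω → ℝ) {δ : ℝ}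
    (hδ : 0 < δ) : ∃ r : ℝ, 0 < r ∧ r < 1 ∧ ∀ n : ℕ,
      ∑ x : Fin n → Ω, (if n * δ < ∑ i, f (x i) - n * ∑ y, q y * f y then ∏ i, q (x i) else 0)
        ≤ r ^ n := by
  set μ := ∑ y, q y * f y with hμ
  obtain ⟨s, hs, hlt⟩ := exists_sum_mul_exp_lt_one q1 (g := fun x => f x - μ - δ) (by
    have : ∑ x, q x * (f x - μ - δ) = μ - (∑ x, q x) * μ - (∑ x, q x) * δ := by
      rw [hμ, Finset.sum_mul, Finset.sum_mul, ← Finset.sum_sub_distrib, ← Finset.sum_sub_distrib]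
      exact Finset.sum_congr rfl fun x _ => by ring
    rw [this, q1]; linarith)
  obtain ⟨y, hy⟩ : ∃ y, q y ≠ 0 := by
    by_contra! hc
    simp [hc] at q1
  refine ⟨_, ?_, hlt, fun n => ?_⟩
  · exact Finset.sum_pos' (fun x _ => mul_nonneg (q0 x) (Real.exp_pos _).le)
      ⟨y, Finset.mem_univ y, mul_pos ((q0 y).lt_of_ne' hy) (Real.exp_pos _)⟩
  · have h2 := Finset.prod_univ_sum (fun _ : Fin n => (Finset.univ : Finset Ω))
      fun _ x => q x * Real.exp (s * (f x - μ - δ))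
    simp only [Finset.prod_const, Finset.card_univ, Fintype.card_fin, Fintype.piFinset_univ] at h2
    rw [h2]
    refine Finset.sum_le_sum fun x _ => ?_
    have hq : 0 ≤ ∏ i, q (x i) := Finset.prod_nonneg fun i _ => q0 _
    rw [Finset.prod_mul_distrib, ← Real.exp_sum]
    split_ifs with h
    · refine le_mul_of_one_le_right hq (Real.one_le_exp ?_)
      rw [← Finset.mul_sum]
      refine mul_nonneg hs.le ?_
      simp only [Finset.sum_sub_distrib, Finset.sum_const, Finset.card_univ, Fintype.card_fin,
        nsmul_eq_mul]
      linarith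
    · exact mul_nonneg hq (Real.exp_pos _).le

open Classical in
theorem exists_abs_tail_le (q0 : ∀ x, 0 ≤ q x) (q1 : ∑ x, q x = 1) (f : Ω → ℝ) {δ : ℝ}
    (hδ : 0 < δ) : ∃ r : ℝ, 0 < r ∧ r < 1 ∧ ∀ n : ℕ,
      ∑ x : Fin n → Ω, (if n * δ < |∑ i, f (x i) - n * ∑ y, q y * f y| then ∏ i, q (x i) else 0)
        ≤ 2 * r ^ n := by
  obtain ⟨r, h0, h1, h⟩ := exists_tail_le q0 q1 f hδ
  obtain ⟨r', h0', h1', h'⟩ := exists_tail_le q0 q1 (fun x => -f x) hδ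
  refine ⟨max r r', lt_max_of_lt_left h0, max_lt h1 h1', fun n => ?_⟩
  have e := pow_le_pow_left₀ h0.le (le_max_left r r') n
  have e' := pow_le_pow_left₀ h0'.le (le_max_right r r') n
  have : ∑ x : Fin n → Ω,
      (if n * δ < |∑ i, f (x i) - n * ∑ y, q y * f y| then ∏ i, q (x i) else 0) ≤
      ∑ x : Fin n → Ω, (if n * δ < ∑ i, f (x i) - n * ∑ y, q y * f y then ∏ i, q (x i) else 0) +
      ∑ x : Fin n → Ω,
        (if n * δ < ∑ i, -f (x i) - n * ∑ y, q y * -f y then ∏ i, q (x i) else 0) := by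
    rw [← Finset.sum_add_distrib]
    refine Finset.sum_le_sum fun x _ => ?_
    have hq : 0 ≤ ∏ i, q (x i) := Finset.prod_nonneg fun i _ => q0 _
    simp only [mul_neg, Finset.sum_neg_distrib, lt_abs]
    split_ifs with ha hb hc hc hb hc hc <;> first | linarith | skip
    rcases ha with ha | ha
    · exact absurd ha hb
    · exact absurd (by linarith) hc
  linarith [h n, h' n]

end Chernoff

/-! ### Averages over independent codewords -/

section Average

variable {κ X : Type*} [Fintype κ] [DecidableEq κ] [Fintype X] {w : X → ℝ}

theorem sum_prod_eq_one (hw : ∑ a, w a = 1) : ∑ c : κ → X, ∏ k, w (c k) = 1 := by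
  classical
  have h2 := Finset.prod_univ_sum (fun _ : κ => (Finset.univ : Finset X)) fun _ x => w x
  simpa [hw] using h2.symm

/-- Conditioning an independent family on the value of its member `i`. -/
theorem sum_prod_split (i : κ) (G : (κ → X) → ℝ) : ∑ c : κ → X, (∏ k, w (c k)) * G c =
    ∑ a, w a * ∑ c : {k // k ≠ i} → X, (∏ k, w (c k)) * G ((Equiv.funSplitAt i X).symm (a, c)) := by
  rw [← (Equiv.funSplitAt i X).symm.sum_comp, Fintype.sum_prod_type]
  refine Finset.sum_congr rfl fun a _ => ?_
  rw [Finset.mul_sum]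
  refine Finset.sum_congr rfl fun c _ => ?_
  rw [← mul_assoc, Fintype.prod_eq_mul_prod_subtype_ne _ i]
  congr 2
  · simp
  · refine Finset.prod_congr rfl fun k _ => ?_
    simp [k.2]

theorem sum_prod_mul_apply (hw : ∑ a, w a = 1) (i : κ) (F : X → ℝ) :
    ∑ c : κ → X, (∏ k, w (c k)) * F (c i) = ∑ a, w a * F a := by
  rw [sum_prod_split i]
  refine Finset.sum_congr rfl fun a _ => ?_
  simp [← Finset.sum_mul, sum_prod_eq_one hw]

theorem sum_prod_mul_apply₂ (hw : ∑ a, w a = 1) {i l : κ} (hil : l ≠ i) (F : X → X → ℝ) :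
    ∑ c : κ → X, (∏ k, w (c k)) * F (c i) (c l) = ∑ a, w a * ∑ b, w b * F a b := by
  rw [sum_prod_split i]
  refine Finset.sum_congr rfl fun a _ => ?_
  congr 1
  rw [← sum_prod_mul_apply hw (⟨l, hil⟩ : {k // k ≠ i}) (F a)]
  simp [hil]

end Average

namespace Ensemble

variable {A ι : Type*} [Fintype A] [Fintype ι] (E : Ensemble A ι)

/-- The probability `p_j = ∏ p_{j_i}` of a codeword. -/
def wordProb {n : ℕ} (j : Fin n → A) : ℝ := ∏ i, E.p (j i)

theorem wordProb_nonneg {n : ℕ} (j : Fin n → A) : 0 ≤ E.wordProb j :=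
  Finset.prod_nonneg fun _ _ => E.p_nonneg _

theorem sum_wordProb (n : ℕ) : ∑ j : Fin n → A, E.wordProb j = 1 := sum_prod_eq_one E.p_sum

variable {n N : ℕ}

theorem codeAvg_apply (l : Fin N) (F : (Fin n → A) → ℝ) :
    (E.codeAvg n N fun c => F (c l)) = ∑ j, E.wordProb j * F j :=
  sum_prod_mul_apply (E.sum_wordProb n) l F

theorem codeAvg_apply₂ {i l : Fin N} (h : l ≠ i) (F : (Fin n → A) → (Fin n → A) → ℝ) :
    (E.codeAvg n N fun c => F (c i) (c l)) =
      ∑ a, E.wordProb a * ∑ b, E.wordProb b * F a b :=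
  sum_prod_mul_apply₂ (E.sum_wordProb n) h F

theorem codeAvg_mono {f g : (Fin N → Fin n → A) → ℝ} (h : ∀ c, f c ≤ g c) :
    E.codeAvg n N f ≤ E.codeAvg n N g :=
  Finset.sum_le_sum fun c _ => mul_le_mul_of_nonneg_left (h c)
    (Finset.prod_nonneg fun _ _ => Finset.prod_nonneg fun _ _ => E.p_nonneg _)

theorem codeAvg_const (a : ℝ) : (E.codeAvg n N fun _ => a) = a := by
  have : ∑ c : Fin N → Fin n → A, ∏ l, E.wordProb (c l) = 1 := sum_prod_eq_one (E.sum_wordProb n)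
  unfold codeAvg
  rw [← Finset.sum_mul]
  exact (congrArg (· * a) this).trans (one_mul a)

theorem codeAvg_add (f g : (Fin N → Fin n → A) → ℝ) :
    (E.codeAvg n N fun c => f c + g c) = E.codeAvg n N f + E.codeAvg n N g := by
  simp [codeAvg, mul_add, Finset.sum_add_distrib]

theorem codeAvg_const_mul (a : ℝ) (f : (Fin N → Fin n → A) → ℝ) :
    (E.codeAvg n N fun c => a * f c) = a * E.codeAvg n N f := by
  simp [codeAvg, Finset.mul_sum, mul_left_comm]

theorem codeAvg_sub (f g : (Fin N → Fin n → A) → ℝ) :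
    (E.codeAvg n N fun c => f c - g c) = E.codeAvg n N f - E.codeAvg n N g := by
  simp [codeAvg, mul_sub, Finset.sum_sub_distrib]

theorem codeAvg_sum {τ : Type*} (s : Finset τ) (f : τ → (Fin N → Fin n → A) → ℝ) :
    (E.codeAvg n N fun c => ∑ t ∈ s, f t c) = ∑ t ∈ s, E.codeAvg n N (f t) := by
  simp only [codeAvg, Finset.mul_sum]
  exact Finset.sum_comm

theorem avg_posSemidef : E.avg.PosSemidef :=
  Matrix.posSemidef_sum _ fun j _ => (E.ρ_pos j).smul (by exact_mod_cast E.p_nonneg j)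

theorem avg_trace : E.avg.trace = 1 := by
  simp only [avg, Matrix.trace_sum, Matrix.trace_smul, E.ρ_trace, smul_eq_mul, mul_one]
  exact_mod_cast E.p_sum

theorem sum_wordProb_smul_codeState :
    ∑ j : Fin n → A, (E.wordProb j : ℂ) • E.codeState j = tensorMat fun _ : Fin n => E.avg := by
  ext x y
  have := Finset.prod_univ_sum (fun _ : Fin n => (Finset.univ : Finset A))
    fun i j => (E.p j : ℂ) * E.ρ j (x i) (y i)
  simp only [Fintype.piFinset_univ, Finset.prod_mul_distrib] at this
  simp [Matrix.sum_apply, codeState, tensorMat, wordProb, avg, this]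

theorem sum_wordProb_mul_re_trace (M : Matrix (Fin n → ι) (Fin n → ι) ℂ) :
    ∑ j : Fin n → A, E.wordProb j * (M * E.codeState j).trace.re =
      (M * tensorMat fun _ : Fin n => E.avg).trace.re := by
  rw [← sum_wordProb_smul_codeState, Finset.mul_sum, Matrix.trace_sum, Complex.re_sum]
  refine Finset.sum_congr rfl fun j _ => ?_
  simp

end Ensemble

namespace Ensemble

variable {A ι : Type*} [Fintype A] [Fintype ι] [DecidableEq ι] (E : Ensemble A ι)

/-! ### Typicality holds up to an exponentially small probability -/

/-- The average codeword state lies in the typical subspace up to an exponentially small weight. -/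
theorem exists_typP_tail {δ : ℝ} (hδ : 0 < δ) : ∃ r : ℝ, 0 < r ∧ r < 1 ∧ ∀ n : ℕ, 0 < n →
    ∑ j : Fin n → A, E.wordProb j * ((1 - E.typP n δ) * E.codeState j).trace.re ≤ 2 * r ^ n := by
  classical
  set q := E.avg_isHermitian.eigenvalues with hq
  have q0 : ∀ x, 0 ≤ q x := fun x => E.avg_posSemidef.eigenvalues_nonneg x
  obtain ⟨r, h0, h1, h⟩ := exists_abs_tail_le q0
    (sum_eigenvalues_eq_one E.avg_isHermitian E.avg_trace) (fun x => -Real.logb 2 (q x)) hδ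
  refine ⟨r, h0, h1, fun n hn => ?_⟩
  have hS : ∑ x, q x * -Real.logb 2 (q x) = vnEntropy E.avg_isHermitian := by
    simp [vnEntropy, hq]
  rw [sum_wordProb_mul_re_trace, typP,
    re_trace_one_sub_typicalProj_mul (fun _ : Fin n => E.avg_isHermitian)]
  refine le_trans (Finset.sum_le_sum fun x _ => ?_) (h n)
  rw [hS]
  have hp : 0 ≤ ∏ i, q (x i) := Finset.prod_nonneg fun i _ => q0 _
  split_ifs with ha hb hb <;> first | exact hp | exact le_rfl | skip
  -- strings of eigenvalue `0` are never typical, but they carry no weight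
  rcases hp.eq_or_lt with h0 | h0
  · exact h0.ge
  · exact absurd (lt_abs_sum_logb_of_notMem_typicalSet (fun _ : Fin n => E.avg_isHermitian)
      hn ha h0) hb

/-- A random codeword state lies in its conditionally typical subspace up to an exponentially small
weight.  The letters of the Chernoff bound are the pairs `(j, x)` with probability `p_j λ_x^{(j)}`,
and the mean of `-log₂ λ_x^{(j)}` is the conditional entropy. -/
theorem exists_condP_tail {δ : ℝ} (hδ : 0 < δ) : ∃ r : ℝ, 0 < r ∧ r < 1 ∧ ∀ n : ℕ, 0 < n →
    ∑ j : Fin n → A, E.wordProb j * ((1 - E.condP δ j) * E.codeState j).trace.re ≤ 2 * r ^ n := by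
  classical
  set q : A → ι → ℝ := fun j => (E.isHermitian j).eigenvalues with hq
  have q0 : ∀ j x, 0 ≤ q j x := fun j x => (E.ρ_pos j).eigenvalues_nonneg x
  have hsum : ∑ y : A × ι, E.p y.1 * q y.1 y.2 = 1 := by
    rw [Fintype.sum_prod_type]
    simp only [← Finset.mul_sum, hq, sum_eigenvalues_eq_one _ (E.ρ_trace _), mul_one, E.p_sum]
  obtain ⟨r, h0, h1, h⟩ := exists_abs_tail_le (q := fun y : A × ι => E.p y.1 * q y.1 y.2)
    (fun y => mul_nonneg (E.p_nonneg _) (q0 _ _)) hsum (fun y => -Real.logb 2 (q y.1 y.2)) hδ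
  refine ⟨r, h0, h1, fun n hn => ?_⟩
  have hS : ∑ y : A × ι, E.p y.1 * q y.1 y.2 * -Real.logb 2 (q y.1 y.2) = E.condEntropy := by
    rw [Fintype.sum_prod_type]
    simp only [condEntropy, vnEntropy, hq, mul_assoc, ← Finset.mul_sum, mul_neg,
      Finset.sum_neg_distrib]
  have h := h n
  rw [hS, ← (Equiv.arrowProdEquivProdArrow (Fin n) (fun _ => A) (fun _ => ι)).symm.sum_comp,
    Fintype.sum_prod_type] at h
  refine le_trans (Finset.sum_le_sum fun j _ => ?_) h
  rw [condP, codeState, re_trace_one_sub_typicalProj_mul, Finset.mul_sum]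
  refine Finset.sum_le_sum fun x _ => ?_
  have hp : 0 ≤ ∏ i, q (j i) (x i) := Finset.prod_nonneg fun i _ => q0 _ _
  have hw := E.wordProb_nonneg j
  simp only [Equiv.arrowProdEquivProdArrow_symm_apply, Finset.prod_mul_distrib]
  change E.wordProb j * _ ≤ if _ then E.wordProb j * _ else 0
  split_ifs with ha hb hb
  · simpa using mul_nonneg hw hp
  · simp
  · exact le_rfl
  · rcases hp.eq_or_lt with h0 | h0
    · -- atypical because an eigenvalue vanishes, hence without weight
      rw [hq] at h0; rw [← h0, mul_zero]
    · exact absurd (lt_abs_sum_logb_of_notMem_typicalSet (fun i => E.isHermitian (j i))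
        hn ha h0) hb

/-! ### The sequential measurement -/

variable {n N : ℕ} (δ : ℝ)

theorem codeState_nonneg (j : Fin n → A) : 0 ≤ E.codeState j := by
  rw [codeState, tensorMat_eq_conjDiag fun i => E.isHermitian (j i)]
  exact conjDiag_nonneg _ fun x => Finset.prod_nonneg fun i _ => (E.ρ_pos _).eigenvalues_nonneg _

theorem codeState_trace (j : Fin n → A) : (E.codeState j).trace.re = 1 := by
  rw [codeState, tensorMat_eq_conjDiag fun i => E.isHermitian (j i), re_trace_conjDiag]
  exact sum_prod_eigenvalues _ fun i => E.ρ_trace _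

theorem typP_nonneg (n : ℕ) : 0 ≤ E.typP n δ := typicalProj_nonneg _ _ _
theorem one_sub_typP_nonneg (n : ℕ) : 0 ≤ 1 - E.typP n δ := one_sub_typicalProj_nonneg _ _ _
theorem typP_mul_self (n : ℕ) : E.typP n δ * E.typP n δ = E.typP n δ := typicalProj_mul_self _ _ _
theorem star_typP (n : ℕ) : star (E.typP n δ) = E.typP n δ :=
  (IsSelfAdjoint.of_nonneg (E.typP_nonneg δ n)).star_eq

theorem condP_nonneg (j : Fin n → A) : 0 ≤ E.condP δ j := typicalProj_nonneg _ _ _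
theorem one_sub_condP_nonneg (j : Fin n → A) : 0 ≤ 1 - E.condP δ j :=
  one_sub_typicalProj_nonneg _ _ _
theorem condP_mul_self (j : Fin n → A) : E.condP δ j * E.condP δ j = E.condP δ j :=
  typicalProj_mul_self _ _ _

theorem precedingQ_mem {c : Fin N → Fin n → A} {l : Fin N} {a : Matrix (Fin n → ι) (Fin n → ι) ℂ}
    (ha : a ∈ E.precedingQ δ c l) : 0 ≤ a ∧ a ≤ 1 := by
  obtain ⟨i, -, rfl⟩ := List.mem_map.1 ha
  exact ⟨E.one_sub_condP_nonneg δ _, sub_le_self _ (E.condP_nonneg δ _)⟩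

/-- As `P_l` is a projector, `E_l = X†X` with `X = P_l Q_{l-1} ⋯ Q_1`, the form that the union bound
needs. -/
theorem seqElem_eq_prod (c : Fin N → Fin n → A) (l : Fin N) :
    E.seqElem δ c l = (E.precedingQ δ c l ++ [E.condP δ (c l)]).prod *
      (E.precedingQ δ c l ++ [E.condP δ (c l)]).reverse.prod := by
  simp only [seqElem, List.prod_append, List.reverse_append, List.prod_singleton,
    List.reverse_singleton]
  calc _ = (E.precedingQ δ c l).prod * (E.condP δ (c l) * E.condP δ (c l)) *
        (E.precedingQ δ c l).reverse.prod := by rw [condP_mul_self]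
    _ = _ := by simp only [mul_assoc]

theorem mem_append_condP {c : Fin N → Fin n → A} {l : Fin N}
    {a : Matrix (Fin n → ι) (Fin n → ι) ℂ}
    (ha : a ∈ E.precedingQ δ c l ++ [E.condP δ (c l)]) : 0 ≤ a ∧ a ≤ 1 := by
  rcases List.mem_append.1 ha with ha | ha
  · exact E.precedingQ_mem δ ha
  · rw [List.mem_singleton.1 ha]
    exact ⟨E.condP_nonneg δ _, sub_nonneg.1 (E.one_sub_condP_nonneg δ _)⟩

theorem seqElem_nonneg (c : Fin N → Fin n → A) (l : Fin N) : 0 ≤ E.seqElem δ c l := by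
  rw [seqElem_eq_prod]
  exact prod_mul_reverse_prod_nonneg fun a ha => (E.mem_append_condP δ ha).1

theorem sum_seqElem_le_one (c : Fin N → Fin n → A) : ∑ l, E.seqElem δ c l ≤ 1 := by
  have h := sum_sequential (fun l => E.condP δ (c l)) fun l => E.condP_mul_self δ _
  simp only [seqElem, precedingQ]
  rw [h]
  refine sub_le_self _ (prod_mul_reverse_prod_nonneg fun a ha => ?_)
  obtain ⟨i, -, rfl⟩ := List.mem_map.1 ha
  exact E.one_sub_condP_nonneg δ _

/-- Decoding `l` in sequence fails only if some earlier codeword is wrongly accepted or `l` is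
rejected. -/
theorem one_sub_seqElem_le (c : Fin N → Fin n → A) (l : Fin N) :
    1 - E.seqElem δ c l ≤
      4 * (∑ i ∈ Finset.univ.filter (· < l), E.condP δ (c i) + (1 - E.condP δ (c l))) := by
  have h := union_bound _ fun a ha => E.mem_append_condP δ (c := c) (l := l) ha
  rw [← seqElem_eq_prod] at h
  convert h using 2
  rw [List.map_append, List.sum_append, List.map_singleton, List.sum_singleton, condP_mul_self,
    precedingQ, List.map_map]
  congr 1
  have hnd : ((List.finRange N).filter (· < l)).Nodup := (List.nodup_finRange N).filter _
  rw [← List.sum_toFinset _ hnd]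
  refine Finset.sum_congr ?_ fun i _ => ?_
  · ext i; simp
  · simp only [Function.comp_apply, sub_mul, mul_sub, condP_mul_self, one_mul, mul_one]
    abel

theorem compressed_trace (j : Fin n → A) :
    (E.typP n δ * E.codeState j * E.typP n δ).trace.re =
      1 - ((1 - E.typP n δ) * E.codeState j).trace.re := by
  rw [Matrix.trace_mul_comm, ← mul_assoc, typP_mul_self, sub_mul, Matrix.trace_sub,
    Complex.sub_re, one_mul, codeState_trace]
  ring

theorem compressed_nonneg (j : Fin n → A) :
    0 ≤ E.typP n δ * E.codeState j * E.typP n δ := by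
  have := star_right_conjugate_nonneg (E.codeState_nonneg j) (E.typP n δ)
  rwa [star_typP] at this

theorem trace_mul_compressed (M : Matrix (Fin n → ι) (Fin n → ι) ℂ) (j : Fin n → A) :
    (M * (E.typP n δ * E.codeState j * E.typP n δ)).trace.re =
      (E.typP n δ * M * E.typP n δ * E.codeState j).trace.re := by
  rw [← mul_assoc, Matrix.trace_mul_comm]
  simp only [mul_assoc]

theorem complement_conj_le {M : Matrix (Fin n → ι) (Fin n → ι) ℂ} (hM : M ≤ 1) :
    (1 - E.typP n δ) * M * (1 - E.typP n δ) ≤ 1 - E.typP n δ := by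
  have h := star_left_conjugate_le_conjugate hM (1 - E.typP n δ)
  rw [star_sub, star_one, star_typP, mul_one] at h
  refine h.trans_eq ?_
  simp [sub_mul, mul_sub, typP_mul_self]

/-- Compressing the state to the typical subspace raises the probability of an effect at most by a
factor two, up to the weight of the state outside the subspace. -/
theorem re_trace_mul_compressed_le {M : Matrix (Fin n → ι) (Fin n → ι) ℂ} (h0 : 0 ≤ M)
    (h1 : M ≤ 1) (j : Fin n → A) :
    (M * (E.typP n δ * E.codeState j * E.typP n δ)).trace.re ≤
      2 * (M * E.codeState j).trace.re + 2 * ((1 - E.typP n δ) * E.codeState j).trace.re := by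
  have e1 := re_trace_mul_le (compression_le h0 (E.star_typP δ n)) (E.codeState_nonneg j)
  have e2 := re_trace_mul_le (E.complement_conj_le δ h1) (E.codeState_nonneg j)
  rw [add_mul, Matrix.trace_add, Complex.add_re, re_trace_two_mul, re_trace_two_mul] at e1
  rw [trace_mul_compressed]
  linarith

theorem re_trace_mul_le_compressed {M : Matrix (Fin n → ι) (Fin n → ι) ℂ} (h0 : 0 ≤ M)
    (h1 : M ≤ 1) (j : Fin n → A) :
    (M * E.codeState j).trace.re ≤
      2 * (M * (E.typP n δ * E.codeState j * E.typP n δ)).trace.re +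
        2 * ((1 - E.typP n δ) * E.codeState j).trace.re := by
  have e1 := re_trace_mul_le (pinching h0 (E.star_typP δ n)) (E.codeState_nonneg j)
  have e2 := re_trace_mul_le (E.complement_conj_le δ h1) (E.codeState_nonneg j)
  rw [add_mul, Matrix.trace_add, Complex.add_re, re_trace_two_mul, re_trace_two_mul] at e1
  rw [trace_mul_compressed]
  linarith

/-- The errors of the sequential decoder on the state `P ρ_l P`: atypicality of `ρ_l` with respect to
`P` and to `P_l`, and confusion with an earlier codeword. -/
theorem le_re_trace_seqElem_mul (c : Fin N → Fin n → A) (l : Fin N) :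
    1 - 9 * ((1 - E.typP n δ) * E.codeState (c l)).trace.re
        - 8 * ((1 - E.condP δ (c l)) * E.codeState (c l)).trace.re
        - 4 * ∑ i ∈ Finset.univ.filter (· < l),
          (E.condP δ (c i) * (E.typP n δ * E.codeState (c l) * E.typP n δ)).trace.re ≤
      (E.seqElem δ c l * (E.typP n δ * E.codeState (c l) * E.typP n δ)).trace.re := by
  have h := re_trace_mul_le (E.one_sub_seqElem_le δ c l) (E.compressed_nonneg δ (c l))
  have h2 := E.re_trace_mul_compressed_le δ (E.one_sub_condP_nonneg δ (c l))
    (sub_le_self _ (E.condP_nonneg δ (c l))) (c l)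
  rw [re_trace_four_mul, sub_mul, one_mul, Matrix.trace_sub, Complex.sub_re,
    compressed_trace, add_mul, Matrix.trace_add, Complex.add_re, Finset.sum_mul,
    Matrix.trace_sum, Complex.re_sum] at h
  linarith

/-- The packing estimate: two independent codewords are confused with probability at most
`2^{-n(χ - 2δ)}`, because `P ρ^{⊗n} P ≤ 2^{-n(S(ρ) - δ)}` and the conditionally typical subspaces
have dimension at most `2^{n(∑ p_j S(ρ_j) + δ)}`. -/
theorem avg_cross_le (hn : 0 < n) (δ : ℝ) :
    ∑ a : Fin n → A, E.wordProb a * ∑ b, E.wordProb b *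
      (E.condP δ a * (E.typP n δ * E.codeState b * E.typP n δ)).trace.re ≤
    (2 : ℝ) ^ (-(n * (E.holevo - 2 * δ))) := by
  set C := E.condEntropy with hC
  set S := vnEntropy E.avg_isHermitian with hS
  have hexp : (2 : ℝ) ^ (-(n * (S - δ))) * (2 : ℝ) ^ (n * (C + δ)) =
      (2 : ℝ) ^ (-(n * (E.holevo - 2 * δ))) := by
    rw [← Real.rpow_add (by norm_num), holevo]
    congr 1
    ring
  -- averaging over the transmitted codeword first turns `ρ_b` into `ρ^{⊗n}`
  have key : ∀ a : Fin n → A, ∑ b, E.wordProb b *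
      (E.condP δ a * (E.typP n δ * E.codeState b * E.typP n δ)).trace.re ≤
      (2 : ℝ) ^ (-(n * (E.holevo - 2 * δ))) := fun a => by
    simp only [trace_mul_compressed]
    rw [sum_wordProb_mul_re_trace, ← hexp]
    have h1 := re_trace_mul_le (typicalProj_mul_tensorMat_mul_le
      (fun _ : Fin n => E.avg_isHermitian) hn S δ) (E.condP_nonneg δ a)
    have h2 := re_trace_typicalProj_le (fun i => E.isHermitian (a i)) hn
      (fun i => E.ρ_pos (a i)) (fun i => E.ρ_trace (a i)) C δ
    calc _ = (E.typP n δ * tensorMat (fun _ : Fin n => E.avg) * E.typP n δ *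
          E.condP δ a).trace.re := by
          rw [Matrix.trace_mul_comm, ← mul_assoc, ← mul_assoc, Matrix.trace_mul_comm,
            ← mul_assoc, ← mul_assoc]
      _ ≤ _ := h1
      _ = (2 : ℝ) ^ (-(n * (S - δ))) * (E.condP δ a).trace.re := by
          rw [smul_mul_assoc, one_mul, Matrix.trace_smul, smul_eq_mul, Complex.re_ofReal_mul]
      _ ≤ _ := mul_le_mul_of_nonneg_left h2 (by positivity)
  calc _ ≤ ∑ a : Fin n → A, E.wordProb a * (2 : ℝ) ^ (-(n * (E.holevo - 2 * δ))) :=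
        Finset.sum_le_sum fun a _ => mul_le_mul_of_nonneg_left (key a) (E.wordProb_nonneg a)
    _ = _ := by rw [← Finset.sum_mul, sum_wordProb, one_mul]

/-! ### The bisection protocol -/

section Protocol

variable {n m : ℕ} (δ : ℝ) (enc : Fin (2 ^ m) ≃ (Fin m → Bool)) (c : Fin (2 ^ m) → Fin n → A)

theorem setMeas_nonneg (k : List Bool) : 0 ≤ E.setMeas δ enc c k :=
  Finset.sum_nonneg fun l _ => E.seqElem_nonneg δ c l

theorem setMeas_le_one (k : List Bool) : E.setMeas δ enc c k ≤ 1 :=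
  (Finset.sum_le_sum_of_subset_of_nonneg (Finset.filter_subset _ _)
    fun l _ _ => E.seqElem_nonneg δ c l).trans (E.sum_seqElem_le_one δ c)

theorem seqElem_le_setMeas {k : List Bool} {l : Fin (2 ^ m)} (h : k <+: bitString enc l) :
    E.seqElem δ c l ≤ E.setMeas δ enc c k :=
  Finset.single_le_sum (f := fun l => E.seqElem δ c l) (fun l _ => E.seqElem_nonneg δ c l)
    (Finset.mem_filter.2 ⟨Finset.mem_univ l, h⟩)

/-- The two children of a prefix `k` sum over disjoint sets of messages. -/
theorem setMeas_isThreeOutcomePOVM (k : List Bool) :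
    IsThreeOutcomePOVM (E.setMeas δ enc c (k ++ [false])) (E.setMeas δ enc c (k ++ [true])) := by
  refine ⟨Matrix.nonneg_iff_posSemidef.1 (E.setMeas_nonneg δ enc c _),
    Matrix.nonneg_iff_posSemidef.1 (E.setMeas_nonneg δ enc c _), ?_⟩
  rw [sub_sub, ← Matrix.nonneg_iff_posSemidef, sub_nonneg]
  have hd : Disjoint
      (Finset.univ.filter fun l => (k ++ [false]) <+: bitString enc l)
      (Finset.univ.filter fun l => (k ++ [true]) <+: bitString enc l) := by
    rw [Finset.disjoint_filter]
    intro l _ h0 h1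
    have := (List.prefix_of_prefix_length_le h0 h1 (by simp)).eq_of_length (by simp)
    simp at this
  refine le_trans ?_ (E.sum_seqElem_le_one δ c)
  unfold setMeas
  rw [← Finset.sum_union hd]
  exact Finset.sum_le_sum_of_subset_of_nonneg (Finset.subset_univ _)
    fun l _ _ => E.seqElem_nonneg δ c l

theorem bisOp_factor_mem {l : Fin (2 ^ m)} {a : Matrix (Fin n → ι) (Fin n → ι) ℂ}
    (ha : a ∈ (List.range m).map fun u =>
      CFC.sqrt (E.setMeas δ enc c ((bitString enc l).take (u + 1)))) : 0 ≤ a ∧ a ≤ 1 := by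
  obtain ⟨u, -, rfl⟩ := List.mem_map.1 ha
  exact ⟨CFC.sqrt_nonneg _, sqrt_le_one (E.setMeas_nonneg δ enc c _) (E.setMeas_le_one δ enc c _)⟩

theorem bisOp_conjTranspose_mul_self (l : Fin (2 ^ m)) :
    (E.bisOp δ enc c l)ᴴ * E.bisOp δ enc c l =
      ((List.range m).map fun u =>
        CFC.sqrt (E.setMeas δ enc c ((bitString enc l).take (u + 1)))).prod *
      ((List.range m).map fun u =>
        CFC.sqrt (E.setMeas δ enc c ((bitString enc l).take (u + 1)))).reverse.prod := by
  rw [bisOp, ← Matrix.star_eq_conjTranspose,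
    star_reverse_prod fun a ha => (E.bisOp_factor_mem δ enc c ha).1]

theorem pSucc_le_one (l : Fin (2 ^ m)) : E.pSucc δ enc c l ≤ 1 := by
  have h := re_trace_mul_le (prod_mul_reverse_prod_le_one fun a ha =>
    E.bisOp_factor_mem δ enc c (l := l) ha) (E.codeState_nonneg (c l))
  rw [← bisOp_conjTranspose_mul_self, one_mul, codeState_trace] at h
  exact h

/-- The union bound for the `m` steps of the bisection protocol. -/
theorem one_sub_pSucc_le (l : Fin (2 ^ m)) :
    1 - E.pSucc δ enc c l ≤ 4 * ∑ u ∈ Finset.range m,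
      ((1 - E.setMeas δ enc c ((bitString enc l).take (u + 1))) *
        E.codeState (c l)).trace.re := by
  have h := re_trace_mul_le (union_bound _ fun a ha => E.bisOp_factor_mem δ enc c (l := l) ha)
    (E.codeState_nonneg (c l))
  have hs : (((List.range m).map fun u =>
        CFC.sqrt (E.setMeas δ enc c ((bitString enc l).take (u + 1)))).map fun a => 1 - a * a).sum =
      ∑ u ∈ Finset.range m, (1 - E.setMeas δ enc c ((bitString enc l).take (u + 1))) := by
    rw [List.map_map, ← List.sum_toFinset _ List.nodup_range, List.toFinset_range]
    refine Finset.sum_congr rfl fun u _ => ?_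
    rw [Function.comp_apply, CFC.sqrt_mul_sqrt_self _ (E.setMeas_nonneg δ enc c _)]
  rw [← bisOp_conjTranspose_mul_self, hs, re_trace_four_mul, sub_mul, one_mul,
    Matrix.trace_sub, Complex.sub_re, codeState_trace, Finset.sum_mul, Matrix.trace_sum,
    Complex.re_sum] at h
  unfold pSucc
  linarith

/-- Passing from the compressed state `P ρ_l P` to the codeword state `ρ_l` itself. -/
theorem re_trace_one_sub_setMeas_mul_le (k : List Bool) (l : Fin (2 ^ m)) :
    ((1 - E.setMeas δ enc c k) * E.codeState (c l)).trace.re ≤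
      2 * (1 - (E.setMeas δ enc c k *
        (E.typP n δ * E.codeState (c l) * E.typP n δ)).trace.re) +
        2 * ((1 - E.typP n δ) * E.codeState (c l)).trace.re := by
  have h := E.re_trace_mul_le_compressed δ (sub_nonneg.2 (E.setMeas_le_one δ enc c k))
    (sub_le_self _ (E.setMeas_nonneg δ enc c k)) (c l)
  have h0 := re_trace_mul_nonneg (E.one_sub_typP_nonneg δ n) (E.codeState_nonneg (c l))
  rw [sub_mul (1 : Matrix (Fin n → ι) (Fin n → ι) ℂ) (E.setMeas δ enc c k)
    (E.typP n δ * E.codeState (c l) * E.typP n δ), one_mul, Matrix.trace_sub, Complex.sub_re,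
    compressed_trace] at h
  linarith

end Protocol

/-! ### Averaging over random codes -/

section RandomCodes

variable {n m : ℕ} {δ : ℝ} (enc : Fin (2 ^ m) ≃ (Fin m → Bool))

/-- Every set measurement accepts the compressed states of its own messages with high probability,
on average over the codes, because it dominates the sequential element of each of them. The constant
`38 = 9 · 2 + 8 · 2 + 4` collects the two typicality errors and the confusion error. -/
theorem le_codeAvg_setMeas (hn : 0 < n) {R r : ℝ} (hm : (m : ℝ) ≤ n * R)
    (h1 : ∑ j : Fin n → A,
      E.wordProb j * ((1 - E.typP n δ) * E.codeState j).trace.re ≤ 2 * r ^ n)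
    (h2 : ∑ j : Fin n → A,
      E.wordProb j * ((1 - E.condP δ j) * E.codeState j).trace.re ≤ 2 * r ^ n)
    (h3 : (2 : ℝ) ^ (-(E.holevo - 2 * δ - R)) ≤ r) (l : Fin (2 ^ m)) {k : List Bool}
    (hk : k <+: bitString enc l) :
    1 - 38 * r ^ n ≤ E.codeAvg n (2 ^ m) fun c =>
      (E.setMeas δ enc c k * (E.typP n δ * E.codeState (c l) * E.typP n δ)).trace.re := by
  have hcross : E.codeAvg n (2 ^ m) (fun c => ∑ i ∈ Finset.univ.filter (· < l),
      (E.condP δ (c i) * (E.typP n δ * E.codeState (c l) * E.typP n δ)).trace.re) ≤ r ^ n := by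
    set x := (2 : ℝ) ^ (-(n * (E.holevo - 2 * δ))) with hx
    have hx0 : 0 ≤ x := by positivity
    rw [codeAvg_sum]
    calc _ ≤ ∑ i ∈ Finset.univ.filter (· < l), x := by
          refine Finset.sum_le_sum fun i hi => ?_
          rw [E.codeAvg_apply₂ (Finset.mem_filter.1 hi).2.ne' fun a b : Fin n → A =>
            (E.condP δ a * (E.typP n δ * E.codeState b * E.typP n δ)).trace.re]
          exact E.avg_cross_le hn δ
      _ ≤ ((2 ^ m : ℕ) : ℝ) * x := by
          rw [Finset.sum_const, nsmul_eq_mul]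
          refine mul_le_mul_of_nonneg_right ?_ hx0
          exact_mod_cast (Finset.card_le_univ _).trans_eq (Fintype.card_fin _)
      _ ≤ (2 : ℝ) ^ (n * R) * x := by
          refine mul_le_mul_of_nonneg_right ?_ hx0
          rw [Nat.cast_pow, Nat.cast_ofNat, ← Real.rpow_natCast]
          exact Real.rpow_le_rpow_of_exponent_le (by norm_num) hm
      _ = ((2 : ℝ) ^ (-(E.holevo - 2 * δ - R))) ^ n := by
          rw [hx, ← Real.rpow_add (by norm_num), ← Real.rpow_mul_natCast (by norm_num)]
          congr 1
          ring
      _ ≤ r ^ n := pow_le_pow_left₀ (by positivity) h3 n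
  rw [← E.codeAvg_apply l fun j : Fin n → A => ((1 - E.typP n δ) * E.codeState j).trace.re] at h1
  rw [← E.codeAvg_apply l fun j : Fin n → A => ((1 - E.condP δ j) * E.codeState j).trace.re] at h2
  have h := E.codeAvg_mono (n := n) fun c => (E.le_re_trace_seqElem_mul δ c l).trans
    (re_trace_mul_le (E.seqElem_le_setMeas δ enc c hk) (E.compressed_nonneg δ (c l)))
  rw [codeAvg_sub, codeAvg_sub, codeAvg_sub, codeAvg_const, codeAvg_const_mul, codeAvg_const_mul,
    codeAvg_const_mul] at h
  linarith

theorem codeAvg_one_sub_pSucc_le {e : ℝ}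
    (h1 : ∑ j : Fin n → A, E.wordProb j * ((1 - E.typP n δ) * E.codeState j).trace.re ≤ e)
    (l : Fin (2 ^ m))
    (h2 : ∀ u, 1 ≤ u → u ≤ m → 1 - e ≤ E.codeAvg n (2 ^ m) fun c =>
      (E.setMeas δ enc c ((bitString enc l).take u) *
        (E.typP n δ * E.codeState (c l) * E.typP n δ)).trace.re) :
    1 - E.codeAvg n (2 ^ m) (fun c => E.pSucc δ enc c l) ≤ 16 * (m * e) := by
  rw [← E.codeAvg_apply l fun j : Fin n → A => ((1 - E.typP n δ) * E.codeState j).trace.re] at h1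
  have h := E.codeAvg_mono (n := n) fun c => (E.one_sub_pSucc_le δ enc c l).trans
    (mul_le_mul_of_nonneg_left (Finset.sum_le_sum fun u _ =>
      E.re_trace_one_sub_setMeas_mul_le δ enc c ((bitString enc l).take (u + 1)) l)
      (by norm_num : (0 : ℝ) ≤ 4))
  rw [codeAvg_sub, codeAvg_const, codeAvg_const_mul, codeAvg_sum] at h
  refine h.trans ?_
  have : ∀ u ∈ Finset.range m, (E.codeAvg n (2 ^ m) fun c =>
      2 * (1 - (E.setMeas δ enc c ((bitString enc l).take (u + 1)) *
        (E.typP n δ * E.codeState (c l) * E.typP n δ)).trace.re) +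
        2 * ((1 - E.typP n δ) * E.codeState (c l)).trace.re) ≤ 4 * e := fun u hu => by
    have := h2 (u + 1) (by lia) (by have := Finset.mem_range.1 hu; lia)
    rw [codeAvg_add, codeAvg_const_mul, codeAvg_const_mul, codeAvg_sub, codeAvg_const]
    linarith
  have := Finset.sum_le_sum this
  rw [Finset.sum_const, Finset.card_range, nsmul_eq_mul] at this
  linarith

theorem codeAvg_pErr : (E.codeAvg n (2 ^ m) fun c => E.pErr δ enc c) =
    (1 / 2 ^ m : ℝ) * ∑ l, (1 - E.codeAvg n (2 ^ m) fun c => E.pSucc δ enc c l) := by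
  simp only [pErr]
  rw [codeAvg_sub, codeAvg_const, codeAvg_const_mul, codeAvg_sum, Finset.sum_sub_distrib]
  simp only [Finset.sum_const, Finset.card_univ, Fintype.card_fin, nsmul_eq_mul, mul_one]
  push_cast
  field_simp

end RandomCodes
end Ensemble
end Bisection

end

theorem lemma8 {A ι : Type*} [Fintype A] [Fintype ι] [DecidableEq ι]
    (E : Bisection.Ensemble A ι) (R δ : ℝ) (hδ : 0 < δ) (hR : R < E.holevo - 2 * δ)
    (m : ℕ → ℕ) (hm : ∀ n, (m n : ℝ) ≤ n * R)
    (enc : ∀ n, Fin (2 ^ m n) ≃ (Fin (m n) → Bool)) :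
    -- for every code, the set measurements define a bisection scheme
    (∀ (n : ℕ) (c : Fin (2 ^ m n) → Fin n → A) (k : List Bool),
      Bisection.IsThreeOutcomePOVM
        (E.setMeas δ (enc n) c (k ++ [false])) (E.setMeas δ (enc n) c (k ++ [true]))) ∧
    -- sufficient condition (ii)
    (∃ ε : ℕ → ℝ, (∀ n, 0 < ε n) ∧
      Tendsto (fun n : ℕ => (n : ℝ) ^ 2 * ε n) atTop (𝓝 0) ∧
      ∀ (n : ℕ) (l : Fin (2 ^ m n)) (u : ℕ), 1 ≤ u → u ≤ m n →
        1 - ε n ≤ E.codeAvg n (2 ^ m n) fun c =>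
          (E.setMeas δ (enc n) c ((Bisection.bitString (enc n) l).take u) *
            (E.typP n δ * E.codeState (c l) * E.typP n δ)).trace.re) ∧
    -- the success probability of each codeword, averaged over codes, tends to one
    (∀ l : ∀ n, Fin (2 ^ m n),
      Tendsto (fun n => E.codeAvg n (2 ^ m n) fun c => E.pSucc δ (enc n) c (l n))
        atTop (𝓝 1)) ∧
    -- the average error probability, averaged over codes, tends to zero
    Tendsto (fun n => E.codeAvg n (2 ^ m n) fun c => E.pErr δ (enc n) c) atTop (𝓝 0) := by
  obtain ⟨r₁, h₁, h₁', ht₁⟩ := E.exists_typP_tail hδ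
  obtain ⟨r₂, h₂, h₂', ht₂⟩ := E.exists_condP_tail hδ
  have h₃ : (2 : ℝ) ^ (-(E.holevo - 2 * δ - R)) < 1 :=
    Real.rpow_lt_one_of_one_lt_of_neg (by norm_num) (by linarith)
  obtain ⟨r, hr0, hr1, hr₁, hr₂, hr₃⟩ : ∃ r : ℝ, 0 < r ∧ r < 1 ∧ r₁ ≤ r ∧ r₂ ≤ r ∧
      (2 : ℝ) ^ (-(E.holevo - 2 * δ - R)) ≤ r :=
    ⟨max r₁ (max r₂ (2 ^ (-(E.holevo - 2 * δ - R)))), lt_max_of_lt_left h₁,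
      max_lt h₁' (max_lt h₂' h₃), le_max_left _ _, (le_max_left _ _).trans (le_max_right _ _),
      (le_max_right _ _).trans (le_max_right _ _)⟩
  have hrn : ∀ n, 0 < r ^ n := fun n => pow_pos hr0 n
  have hrabs : |r| < 1 := by rwa [abs_of_pos hr0]
  have hm0 : m 0 = 0 := by
    have := hm 0
    simp only [Nat.cast_zero, zero_mul] at this
    exact_mod_cast le_antisymm this (Nat.cast_nonneg _)
  have htyp : ∀ n, 0 < n → ∑ j : Fin n → A,
      E.wordProb j * ((1 - E.typP n δ) * E.codeState j).trace.re ≤ 2 * r ^ n := fun n hn =>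
    (ht₁ n hn).trans (by gcongr)
  have hcond : ∀ n, 0 < n → ∑ j : Fin n → A,
      E.wordProb j * ((1 - E.condP δ j) * E.codeState j).trace.re ≤ 2 * r ^ n := fun n hn =>
    (ht₂ n hn).trans (by gcongr)
  have hii : ∀ (n : ℕ) (l : Fin (2 ^ m n)) (u : ℕ), 1 ≤ u → u ≤ m n →
      1 - 38 * r ^ n ≤ E.codeAvg n (2 ^ m n) fun c =>
        (E.setMeas δ (enc n) c ((Bisection.bitString (enc n) l).take u) *
          (E.typP n δ * E.codeState (c l) * E.typP n δ)).trace.re := by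
    intro n l u hu hun
    have hn : 0 < n := by
      -- `m 0 = 0`, so there is no step `u` when `n = 0`
      rcases Nat.eq_zero_or_pos n with rfl | hn
      · lia
      · exact hn
    exact E.le_codeAvg_setMeas (enc n) hn (hm n) (htyp n hn) (hcond n hn) hr₃ l
      (List.take_prefix _ _)
  -- `608 = 16 · 38`; the bound is uniform in the message, as the average over messages needs
  have hloss : ∀ (n : ℕ), 0 < n → ∀ l : Fin (2 ^ m n),
      1 - E.codeAvg n (2 ^ m n) (fun c => E.pSucc δ (enc n) c l) ≤
        608 * R * (n * r ^ n) := by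
    intro n hn l
    have h := E.codeAvg_one_sub_pSucc_le (enc n) (e := 38 * r ^ n)
      ((htyp n hn).trans (by linarith [hrn n])) l (hii n l)
    have := mul_le_mul_of_nonneg_right (hm n) (hrn n).le
    linarith
  have hgain : ∀ (n : ℕ) (l : Fin (2 ^ m n)),
      0 ≤ 1 - E.codeAvg n (2 ^ m n) (fun c => E.pSucc δ (enc n) c l) := by
    intro n l
    have h := E.codeAvg_mono (n := n) fun c => E.pSucc_le_one δ (enc n) c l
    rw [Bisection.Ensemble.codeAvg_const] at h
    linarith
  have hlim : Tendsto (fun n : ℕ => 608 * R * (n * r ^ n)) atTop (𝓝 0) := by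
    have := (tendsto_self_mul_const_pow_of_abs_lt_one hrabs).const_mul (608 * R)
    rwa [mul_zero] at this
  refine ⟨fun n c k => E.setMeas_isThreeOutcomePOVM δ (enc n) c k,
    ⟨fun n => 38 * r ^ n, fun n => mul_pos (by norm_num) (hrn n), ?_, hii⟩, fun l => ?_, ?_⟩
  · have := (tendsto_pow_const_mul_const_pow_of_abs_lt_one 2 hrabs).const_mul 38
    rw [mul_zero] at this
    exact this.congr fun n => by ring
  · have h0 := squeeze_zero' (Eventually.of_forall fun n => hgain n (l n))
      ((eventually_gt_atTop 0).mono fun n hn => hloss n hn (l n)) hlim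
    simpa using h0.const_sub 1
  · refine squeeze_zero' (Eventually.of_forall fun n => ?_)
      ((eventually_gt_atTop 0).mono fun n hn => ?_) hlim
    · rw [E.codeAvg_pErr]
      exact mul_nonneg (by positivity) (Finset.sum_nonneg fun l _ => hgain n l)
    · rw [E.codeAvg_pErr]
      have h := Finset.sum_le_sum fun l (_ : l ∈ Finset.univ) => hloss n hn l
      rw [Finset.sum_const, Finset.card_univ, Fintype.card_fin, nsmul_eq_mul] at h
      push_cast at h
      rw [one_div, inv_mul_le_iff₀ (by positivity)]
      exact h
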